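/- Let $G$ be a finite group, and write $|x|$ for the order of an element $x\in G$ and $[a,b]=a^{-1}b^{-1}ab$. The $\delta^*_k$-commutators of $G$ are defined recursively: every element of $G$ is a $\delta^*_0$-commutator; for $k\ge 1$, an element $g\in G$ is a $\delta^*_k$-commutator if $g=[a,b]$ for some $a,b\in G$ with $(|a|,|b|)=1$, each of which is a power of a $\delta^*_{k-1}$-commutator of $G$. Let $\delta^*_k(G)$ denote the subgroup of $G$ generated by all $\delta^*_k$-commutators of $G$. Proposition. Let $G$ be a finite soluble group and let $k\ge 1$ be an integer. If $|ab|=|a|\,|b|$ whenever $a$ and $b$ are $\delta^*_k$-commutators of $G$ such that $(|a|,|b|)=1$, then $\delta^*_k(G)$ is nilpotent. -/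

import Mathlib

/-- The set of `δ*ₖ`-commutators of a group `G`. Every element is a `δ*₀`-commutator; `g` is a
`δ*ₖ₊₁`-commutator iff `g = [a, b] = a⁻¹ b⁻¹ a b` with `a`, `b` powers of `δ*ₖ`-commutators
and `(|a|, |b|) = 1`. -/
def deltaStarCommutators (G : Type*) [Group G] : ℕ → Set G
  | 0 => Set.univ
  | k + 1 => {g | ∃ a b : G,
      (∃ x ∈ deltaStarCommutators G k, ∃ m : ℤ, a = x ^ m) ∧
      (∃ y ∈ deltaStarCommutators G k, ∃ n : ℤ, b = y ^ n) ∧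
      Nat.Coprime (orderOf a) (orderOf b) ∧ g = a⁻¹ * b⁻¹ * a * b}

/-- The subgroup `δ*ₖ(G)` generated by all `δ*ₖ`-commutators of `G`. -/
def deltaStar (G : Type*) [Group G] (k : ℕ) : Subgroup G :=
  Subgroup.closure (deltaStarCommutators G k)

/-!
Let `S₀ = G` and let `Sₙ₊₁` be the nilpotent residual of `Sₙ`, generated by the commutators of
elements of coprime orders of `Sₙ`. Then `δ*ₖ(G) ≤ Sₖ`, and `Sₖ` is nilpotent as soon as
`Sₖ₊₁ = 1`.

If `P` is a `p`-group normalized by an element `y` of order prime to `p`, then coprime action makes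
each Engel commutator `⁅…⁅⁅u, y⁆, y⁆…, y⁆` with `u ∈ P` nontrivial when `⁅u, y⁆` is. So from a tower
of groups of prime power order, each acting nontrivially on the next one, we obtain a nontrivial
`δ*ₖ`-commutator `x = ⁅e, y⁆` of `p`-power order with `y` a `δ*ₖ`-commutator of order prime to `p`.
But `x * y` is conjugate to `y`, so `|x * y| = |x| * |y|` would force `x = 1`.

Such a tower with `k + 2` levels exists in a soluble group whenever `Sₖ₊₁ ≠ 1`. By induction on
`|G|`, either some nontrivial normal subgroup `N` does not contain `Sₖ₊₁`, and a tower of `G ⧸ N`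
lifts to `G` by Frattini's argument, or `V = Sₖ₊₁` is a minimal normal subgroup of `G`, hence a
`p`-group for some prime `p`. In the second case `G ⧸ C(V)` has no nontrivial normal `p`-subgroup,
so the last nontrivial term of its series, being nilpotent, has order prime to `p`. This gives
`G ⧸ C(V)` a tower of at least `k + 1` levels whose top is not a `p`-group, and a lift of it acts
nontrivially on `V`.

The commutator `[a, b] = a⁻¹ b⁻¹ a b` in the definition of `δ*ₖ` is `⁅a⁻¹, b⁻¹⁆` in Mathlib's
notation `⁅a, b⁆ = a b a⁻¹ b⁻¹`.
-/

open scoped commutatorElement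

theorem coprime_orderOf_of_isPGroup {G : Type*} [Group G] {p q : ℕ} {P Q : Subgroup G}
    (hP : IsPGroup p P) (hQ : IsPGroup q Q) (hpq : p.Coprime q) {x y : G} (hx : x ∈ P)
    (hy : y ∈ Q) : (orderOf x).Coprime (orderOf y) := by
  simpa only [Subgroup.orderOf_mk] using
    hP.orderOf_coprime (hQ.orderOf_coprime hpq.symm ⟨y, hy⟩).symm ⟨x, hx⟩

section EngelCommutators

variable {G : Type*} [Group G] {k : ℕ} {a b u y : G} {P : Subgroup G}

theorem orderOf_commutatorElement_dvd_of_commute (h : Commute ⁅u, y⁆ y) :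
    orderOf ⁅u, y⁆ ∣ orderOf y := by
  have hconj : ⁅u, y⁆ * y = MulAut.conj u y := conj_eq_commutatorElement_mul.symm
  have hpow : ⁅u, y⁆ ^ orderOf y * y ^ orderOf y = 1 := by
    rw [← h.mul_pow, hconj, ← map_pow, pow_orderOf_eq_one, map_one]
  exact orderOf_dvd_of_pow_eq_one (by simpa using hpow)

theorem commutatorElement_mem_of_mem_normalizer (hu : u ∈ P)
    (hy : y ∈ Subgroup.normalizer (P : Set G)) : ⁅u, y⁆ ∈ P := by
  rw [commutatorElement_def, mul_assoc, mul_assoc]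
  exact P.mul_mem hu (by simpa [mul_assoc] using
    (Subgroup.mem_normalizer_iff.1 hy u⁻¹).1 (P.inv_mem hu))

theorem iterate_commutatorElement_mem (hu : u ∈ P)
    (hy : y ∈ Subgroup.normalizer (P : Set G)) (n : ℕ) : (⁅·, y⁆)^[n] u ∈ P := by
  induction n with
  | zero => exact hu
  | succ n ih =>
    rw [Function.iterate_succ_apply']
    exact commutatorElement_mem_of_mem_normalizer ih hy

theorem commutatorElement_eq_one_of_iterate_eq_one (hu : u ∈ P)
    (hy : y ∈ Subgroup.normalizer (P : Set G))
    (hco : ∀ v ∈ P, (orderOf v).Coprime (orderOf y)) {n : ℕ}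
    (h : (⁅·, y⁆)^[n + 1] u = 1) : ⁅u, y⁆ = 1 := by
  induction n with
  | zero => exact h
  | succ n ih =>
    refine ih ?_
    rw [Function.iterate_succ_apply', Function.iterate_succ_apply'] at h
    rw [Function.iterate_succ_apply']
    refine orderOf_eq_one_iff.1 (Nat.eq_one_of_dvd_coprimes (hco _ ?_) dvd_rfl
      (orderOf_commutatorElement_dvd_of_commute (commutatorElement_eq_one_iff_commute.1 h)))
    exact commutatorElement_mem_of_mem_normalizer (iterate_commutatorElement_mem hu hy n) hy

theorem commutatorElement_mem_deltaStarCommutators_succ (ha : a ∈ deltaStarCommutators G k)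
    (hb : b ∈ deltaStarCommutators G k) (hco : (orderOf a).Coprime (orderOf b)) :
    ⁅a, b⁆ ∈ deltaStarCommutators G (k + 1) :=
  ⟨a⁻¹, b⁻¹, ⟨a, ha, -1, (zpow_neg_one a).symm⟩, ⟨b, hb, -1, (zpow_neg_one b).symm⟩,
    by simpa only [orderOf_inv] using hco, by simp only [inv_inv, commutatorElement_def]⟩

theorem deltaStarCommutators_antitone : Antitone (deltaStarCommutators G) := by
  refine antitone_nat_of_succ_le fun n => ?_
  induction n with
  | zero => exact Set.subset_univ _
  | succ n ih =>
    rintro g ⟨a, b, ⟨x, hx, ha⟩, ⟨y, hy, hb⟩, hco, rfl⟩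
    exact ⟨a, b, ⟨x, ih hx, ha⟩, ⟨y, ih hy, hb⟩, hco, rfl⟩

theorem iterate_commutatorElement_mem_deltaStarCommutators (hu : u ∈ P)
    (hyP : y ∈ Subgroup.normalizer (P : Set G)) (hyk : y ∈ deltaStarCommutators G k)
    (hco : ∀ v ∈ P, (orderOf v).Coprime (orderOf y)) {n : ℕ} (hn : n ≤ k + 1) :
    (⁅·, y⁆)^[n] u ∈ deltaStarCommutators G n := by
  induction n with
  | zero => exact Set.mem_univ _
  | succ n ih =>
    rw [Function.iterate_succ_apply']
    exact commutatorElement_mem_deltaStarCommutators_succ (ih (by lia))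
      (deltaStarCommutators_antitone (by lia : n ≤ k) hyk)
      (hco _ (iterate_commutatorElement_mem hu hyP n))

end EngelCommutators

section LowerFittingSeries

/-- The subgroup generated by the commutators of pairs of elements of coprime orders of `K`. For
finite `K` it is the nilpotent residual of `K`, the last term of the lower central series. -/
def coprimeCommutator {G : Type*} [Group G] (K : Subgroup G) : Subgroup G :=
  Subgroup.closure {g | ∃ a ∈ K, ∃ b ∈ K, (orderOf a).Coprime (orderOf b) ∧ g = ⁅a, b⁆}

/-- The lower Fitting series (iterated nilpotent residuals) of a finite group, encoded through
commutators of elements of coprime orders. -/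
def lowerFittingSeries (G : Type*) [Group G] : ℕ → Subgroup G
  | 0 => ⊤
  | n + 1 => coprimeCommutator (lowerFittingSeries G n)

variable {G H : Type*} [Group G] [Group H] {K : Subgroup G}

theorem commutatorElement_mem_coprimeCommutator {a b : G} (ha : a ∈ K) (hb : b ∈ K)
    (hco : (orderOf a).Coprime (orderOf b)) : ⁅a, b⁆ ∈ coprimeCommutator K :=
  Subgroup.subset_closure ⟨a, ha, b, hb, hco, rfl⟩

theorem coprimeCommutator_le_commutator (K : Subgroup G) : coprimeCommutator K ≤ ⁅K, K⁆ := by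
  rw [coprimeCommutator, Subgroup.closure_le]
  rintro _ ⟨a, ha, b, hb, -, rfl⟩
  exact Subgroup.commutator_mem_commutator ha hb

theorem coprimeCommutator_le (K : Subgroup G) : coprimeCommutator K ≤ K := by
  rw [coprimeCommutator, Subgroup.closure_le]
  rintro _ ⟨a, ha, b, hb, -, rfl⟩
  exact K.mul_mem (K.mul_mem (K.mul_mem ha hb) (K.inv_mem ha)) (K.inv_mem hb)

theorem commute_of_coprimeCommutator_eq_bot (h : coprimeCommutator K = ⊥) {a b : G} (ha : a ∈ K)
    (hb : b ∈ K) (hco : (orderOf a).Coprime (orderOf b)) : Commute a b := by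
  rw [← commutatorElement_eq_one_iff_commute, ← Subgroup.mem_bot, ← h]
  exact commutatorElement_mem_coprimeCommutator ha hb hco

theorem coprimeCommutator_eq_bot_of_le_centralizer
    (h : coprimeCommutator K ≤ Subgroup.centralizer (K : Set G)) : coprimeCommutator K = ⊥ := by
  rw [eq_bot_iff]
  nth_rw 1 [coprimeCommutator]
  rw [Subgroup.closure_le]
  rintro _ ⟨a, ha, b, hb, hco, rfl⟩
  have hcomm {x : G} (hx : x ∈ K) : Commute ⁅a, b⁆ x :=
    (Subgroup.mem_centralizer_iff.1
      (h (commutatorElement_mem_coprimeCommutator ha hb hco)) x hx).symm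
  have hdvd_a : orderOf ⁅a, b⁆ ∣ orderOf a := by
    rw [← orderOf_inv, commutatorElement_inv]
    refine orderOf_commutatorElement_dvd_of_commute ?_
    rw [← commutatorElement_inv]
    exact (hcomm ha).inv_left
  exact orderOf_eq_one_iff.1 (Nat.eq_one_of_dvd_coprimes hco hdvd_a
    (orderOf_commutatorElement_dvd_of_commute (hcomm hb)))

theorem isNilpotent_of_commute_of_coprime_orderOf [Finite G]
    (h : ∀ a b : G, (orderOf a).Coprime (orderOf b) → Commute a b) : Group.IsNilpotent G := by
  refine (Group.isNilpotent_of_finite_tfae.out 0 3 rfl rfl).2 fun p hp P => ?_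
  rw [← Subgroup.normalizer_eq_top_iff, ← Subgroup.index_eq_one,
    Nat.eq_one_iff_not_exists_prime_dvd]
  intro q hq hdvd
  have : Fact q.Prime := ⟨hq⟩
  obtain rfl | hpq := eq_or_ne p q
  · exact P.not_dvd_index (hdvd.trans (Subgroup.index_dvd_of_le Subgroup.le_normalizer))
  · let Q : Sylow q G := default
    refine Q.not_dvd_index (hdvd.trans (Subgroup.index_dvd_of_le ?_))
    refine Subgroup.le_normalizer_iff.2 fun y hy x hx => ?_
    have hxy : Commute x y :=
      h x y (coprime_orderOf_of_isPGroup P.isPGroup' Q.isPGroup'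
        ((Nat.coprime_primes hp.out hq).2 hpq) hx hy)
    rwa [← hxy.eq, mul_inv_cancel_right]

theorem isNilpotent_of_coprimeCommutator_eq_bot [Finite G] (h : coprimeCommutator K = ⊥) :
    Group.IsNilpotent K :=
  isNilpotent_of_commute_of_coprime_orderOf fun a b hco =>
    Subtype.ext (commute_of_coprimeCommutator_eq_bot h a.2 b.2
      (by simpa only [Subgroup.orderOf_coe] using hco)).eq

theorem exists_pow_map_eq_coprime_orderOf (f : G →* H) {a : G} (ha : IsOfFinOrder a) {k : ℕ}
    (hco : (orderOf (f a)).Coprime k) :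
    ∃ s : ℕ, f (a ^ s) = f a ∧ (orderOf (a ^ s)).Coprime k := by
  induction hn : orderOf a using Nat.strong_induction_on generalizing a with
  | _ n ih =>
  obtain hd | hd := eq_or_ne ((orderOf a).gcd k) 1
  · exact ⟨1, by rw [pow_one], by rwa [pow_one]⟩
  set d := (orderOf a).gcd k
  have hfd : (orderOf (f a)).Coprime d := hco.coprime_dvd_right (Nat.gcd_dvd_right _ _)
  obtain ⟨m, hm⟩ := exists_pow_eq_self_of_coprime hfd.symm
  have hdpos : 0 < d := Nat.gcd_pos_of_pos_left _ ha.orderOf_pos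
  have hlt : orderOf (a ^ (d * m)) < n := by
    rw [ha.orderOf_pow, ← hn]
    refine Nat.div_lt_self ha.orderOf_pos ?_
    have hd_dvd : d ∣ (orderOf a).gcd (d * m) :=
      Nat.dvd_gcd (Nat.gcd_dvd_left _ _) (Nat.dvd_mul_right d m)
    have := Nat.le_of_dvd (Nat.gcd_pos_of_pos_left _ ha.orderOf_pos) hd_dvd
    lia
  have hfa : f (a ^ (d * m)) = f a := by rw [map_pow, pow_mul, hm]
  obtain ⟨s, hs, hsco⟩ := ih _ hlt ha.pow (by rwa [hfa]) rfl
  exact ⟨d * m * s, by rw [pow_mul, hs, hfa], by rwa [pow_mul]⟩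

theorem map_coprimeCommutator [Finite G] (f : G →* H) (K : Subgroup G) :
    (coprimeCommutator K).map f = coprimeCommutator (K.map f) := by
  rw [coprimeCommutator, MonoidHom.map_closure, coprimeCommutator]
  congr 1
  ext g
  constructor
  · rintro ⟨_, ⟨a, ha, b, hb, hco, rfl⟩, rfl⟩
    exact ⟨f a, Subgroup.mem_map_of_mem f ha, f b, Subgroup.mem_map_of_mem f hb,
      hco.of_dvd (orderOf_map_dvd f a) (orderOf_map_dvd f b), map_commutatorElement f a b⟩
  · rintro ⟨_, ⟨a, ha, rfl⟩, _, ⟨b, hb, rfl⟩, hco, rfl⟩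
    obtain ⟨s, hfs, hs⟩ := exists_pow_map_eq_coprime_orderOf f (isOfFinOrder_of_finite a) hco
    obtain ⟨t, hft, ht⟩ := exists_pow_map_eq_coprime_orderOf f (isOfFinOrder_of_finite b) hs.symm
    exact ⟨⁅a ^ s, b ^ t⁆, ⟨a ^ s, pow_mem ha s, b ^ t, pow_mem hb t, ht.symm, rfl⟩,
      by rw [map_commutatorElement, hfs, hft]⟩

theorem map_lowerFittingSeries [Finite G] {f : G →* H} (hf : Function.Surjective f) (n : ℕ) :
    (lowerFittingSeries G n).map f = lowerFittingSeries H n := by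
  induction n with
  | zero => exact Subgroup.map_top_of_surjective f hf
  | succ n ih => rw [lowerFittingSeries, lowerFittingSeries, map_coprimeCommutator, ih]

instance lowerFittingSeries_characteristic [Finite G] (n : ℕ) :
    (lowerFittingSeries G n).Characteristic :=
  Subgroup.characteristic_iff_map_eq.2 fun φ => map_lowerFittingSeries φ.surjective n

theorem lowerFittingSeries_antitone : Antitone (lowerFittingSeries G) :=
  antitone_nat_of_succ_le fun n => coprimeCommutator_le (lowerFittingSeries G n)

theorem lowerFittingSeries_le_derivedSeries (n : ℕ) :
    lowerFittingSeries G n ≤ derivedSeries G n := by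
  induction n with
  | zero => exact le_top
  | succ n ih => exact (coprimeCommutator_le_commutator _).trans (Subgroup.commutator_mono ih ih)

theorem exists_lowerFittingSeries_ne_bot_succ_eq_bot [Group.IsSolvable G] {m : ℕ}
    (hm : lowerFittingSeries G m ≠ ⊥) :
    ∃ n ≥ m, lowerFittingSeries G n ≠ ⊥ ∧ lowerFittingSeries G (n + 1) = ⊥ := by
  obtain ⟨d, hd⟩ := Group.IsSolvable.solvable (G := G)
  by_contra! hstep
  have hne : ∀ n ≥ m, lowerFittingSeries G n ≠ ⊥ := fun n hn => Nat.le_induction hm hstep n hn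
  refine hne (max m d) (le_max_left m d) (eq_bot_iff.2 ?_)
  calc lowerFittingSeries G (max m d) ≤ lowerFittingSeries G d :=
        lowerFittingSeries_antitone (le_max_right m d)
    _ ≤ derivedSeries G d := lowerFittingSeries_le_derivedSeries d
    _ = ⊥ := hd

theorem deltaStar_le_lowerFittingSeries (n : ℕ) : deltaStar G n ≤ lowerFittingSeries G n := by
  rw [deltaStar, Subgroup.closure_le]
  induction n with
  | zero => exact Set.subset_univ _
  | succ n ih =>
    rintro _ ⟨a, b, ⟨x, hx, m, rfl⟩, ⟨y, hy, l, rfl⟩, hco, rfl⟩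
    rw [show (x ^ m)⁻¹ * (y ^ l)⁻¹ * x ^ m * y ^ l = ⁅(x ^ m)⁻¹, (y ^ l)⁻¹⁆ by
      simp only [commutatorElement_def, inv_inv]]
    exact commutatorElement_mem_coprimeCommutator (inv_mem (zpow_mem (ih hx) m))
      (inv_mem (zpow_mem (ih hy) l)) (by simpa only [orderOf_inv] using hco)

end LowerFittingSeries

section FrattiniLifting

variable {G H : Type*} [Group G] [Group H] [Finite G] {p : ℕ} [Fact p.Prime]

theorem exists_isPGroup_map_normalizer_eq_top {f : G →* H} (hf : Function.Surjective f)
    {P : Subgroup H} [P.Normal] (hP : IsPGroup p P) :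
    ∃ S : Subgroup G, IsPGroup p S ∧ S.map f = P ∧
      (Subgroup.normalizer (S : Set G)).map f = ⊤ := by
  let M := P.comap f
  let g : M →* P := f.subgroupComap P
  have hg : Function.Surjective g := f.subgroupComap_surjective_of_surjective P hf
  let S : Sylow p M := default
  have hSg : (S : Subgroup M).map g = ⊤ := by
    rw [← S.coe_mapSurjective hg]
    exact ((S.mapSurjective hg).3 (hP.to_subgroup ⊤) le_top).symm
  let S' : Subgroup G := (S : Subgroup M).map M.subtype
  have hSf : S'.map f = P := by
    calc S'.map f = ((S : Subgroup M).map g).map P.subtype := by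
          rw [Subgroup.map_map, Subgroup.map_map]; rfl
      _ = P := by rw [hSg, ← MonoidHom.range_eq_map, Subgroup.range_subtype]
  refine ⟨S', S.isPGroup'.map _, hSf, ?_⟩
  calc (Subgroup.normalizer (S' : Set G)).map f
      = (Subgroup.normalizer (S' : Set G)).map f ⊔ M.map f := by
        rw [Subgroup.map_comap_eq_self_of_surjective hf, ← hSf]
        exact (sup_eq_left.2 (Subgroup.map_mono Subgroup.le_normalizer)).symm
    _ = (Subgroup.normalizer (S' : Set G) ⊔ M).map f := (Subgroup.map_sup _ _ f).symm
    _ = ⊤ := by rw [S.normalizer_sup_eq_top, Subgroup.map_top_of_surjective f hf]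

theorem exists_isPGroup_map_inf_normalizer_eq (f : G →* H) {P : Subgroup H} (hP : IsPGroup p P)
    {J : Subgroup G} (hPJ : P ≤ J.map f) :
    ∃ S ≤ J, IsPGroup p S ∧ S.map f = P ∧
      (J ⊓ Subgroup.normalizer (S : Set G)).map f =
        J.map f ⊓ Subgroup.normalizer (P : Set H) := by
  let J₀ : Subgroup G := J ⊓ (Subgroup.normalizer (P : Set H)).comap f
  have hJ₀ : J₀.map f = J.map f ⊓ Subgroup.normalizer (P : Set H) :=
    SetLike.coe_injective (Set.image_inter_preimage f J (Subgroup.normalizer (P : Set H)))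
  have hPJ₀ : P ≤ J₀.map f := hJ₀ ▸ le_inf hPJ Subgroup.le_normalizer
  have hPn : (P.subgroupOf (J₀.map f)).Normal :=
    Subgroup.normal_subgroupOf_of_le_normalizer (hJ₀.trans_le inf_le_right)
  let f₀ : J₀ →* J₀.map f := f.subgroupMap J₀
  have hmap (S : Subgroup J₀) :
      (S.map J₀.subtype).map f = (S.map f₀).map (J₀.map f).subtype := by
    rw [Subgroup.map_map, Subgroup.map_map]; rfl
  obtain ⟨S, hS, hSP, hSn⟩ := exists_isPGroup_map_normalizer_eq_top
    (f.subgroupMap_surjective J₀) (P := P.subgroupOf (J₀.map f)) hP.comap_subtype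
  have hSf : (S.map J₀.subtype).map f = P := by
    rw [hmap, hSP, Subgroup.subgroupOf_map_subtype, inf_eq_left.2 hPJ₀]
  have hSJ : S.map J₀.subtype ≤ J := (Subgroup.map_subtype_le S).trans inf_le_left
  refine ⟨S.map J₀.subtype, hSJ, hS.map _, hSf, le_antisymm ?_ ?_⟩
  · refine (Subgroup.map_inf_le _ _ f).trans (inf_le_inf_left _ ?_)
    have := Subgroup.le_normalizer_map (H := S.map J₀.subtype) f
    rwa [hSf] at this
  · calc J.map f ⊓ Subgroup.normalizer (P : Set H)
        = ((Subgroup.normalizer (S : Set J₀)).map J₀.subtype).map f := by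
          rw [hmap, hSn, ← MonoidHom.range_eq_map, Subgroup.range_subtype, hJ₀]
      _ ≤ (J ⊓ Subgroup.normalizer (S.map J₀.subtype : Set G)).map f :=
          Subgroup.map_mono (le_inf ((Subgroup.map_subtype_le _).trans inf_le_left)
            (Subgroup.le_normalizer_map _))

end FrattiniLifting

section TowerCommutators

variable {G : Type*} [Group G]

/-- Elements read off from towers of `n + 1` subgroups of `J` of prime power order, each normalized
by the ones below it and with distinct primes for neighbours, the topmost being a `p`-group: an
element `y` read off from the lower part is applied to an element `u` of the topmost subgroup `P` to
form the Engel commutator `⁅…⁅⁅u, y⁆, y⁆…, y⁆`. It is iterated `n + 1` times, which makes all these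
elements `δ*ₙ`-commutators. -/
def towerCommutators : ℕ → ℕ → Subgroup G → Set G
  | 0, p, J => {x | x ∈ J ∧ IsPGroup p (Subgroup.zpowers x)}
  | n + 1, p, J => {x | ∃ P ≤ J, IsPGroup p P ∧ ∃ q, q.Prime ∧ q ≠ p ∧
      ∃ y ∈ towerCommutators n q (J ⊓ Subgroup.normalizer (P : Set G)),
        ∃ u ∈ P, (⁅·, y⁆)^[n + 1] u = x}

variable {n p q : ℕ} {J P : Subgroup G} {u x y : G}

theorem towerCommutators_subset_zero (n p : ℕ) (J : Subgroup G) :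
    towerCommutators n p J ⊆ towerCommutators 0 p J := by
  induction n generalizing p J with
  | zero => exact subset_rfl
  | succ n ih =>
    rintro _ ⟨P, hPJ, hP, q, -, -, y, hy, u, hu, rfl⟩
    have hxP := iterate_commutatorElement_mem hu (ih q _ hy).1.2 (n + 1)
    exact ⟨hPJ hxP, hP.to_le (Subgroup.zpowers_le.2 hxP)⟩

theorem towerCommutators_antitone (p : ℕ) (J : Subgroup G) :
    Antitone (towerCommutators · p J) := by
  refine antitone_nat_of_succ_le fun n => ?_
  induction n generalizing p J with
  | zero => exact towerCommutators_subset_zero 1 p J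
  | succ n ih =>
    rintro _ ⟨P, hPJ, hP, q, hq, hqp, y, hy, u, hu, rfl⟩
    have hyP := (towerCommutators_subset_zero _ q _ hy).1.2
    exact ⟨P, hPJ, hP, q, hq, hqp, y, ih q _ hy, ⁅u, y⁆,
      commutatorElement_mem_of_mem_normalizer hu hyP, rfl⟩

theorem coprime_orderOf_of_mem_towerCommutators (hp : p.Prime) (hq : q.Prime) (hpq : p ≠ q)
    (hP : IsPGroup p P) (hy : y ∈ towerCommutators n q J) :
    ∀ v ∈ P, (orderOf v).Coprime (orderOf y) := fun _ hv =>
  coprime_orderOf_of_isPGroup hP (towerCommutators_subset_zero n q J hy).2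
    ((Nat.coprime_primes hp hq).2 hpq) hv (Subgroup.mem_zpowers y)

theorem towerCommutators_subset_deltaStarCommutators (hp : p.Prime) :
    towerCommutators n p J ⊆ deltaStarCommutators G n := by
  induction n generalizing p J with
  | zero => exact Set.subset_univ _
  | succ n ih =>
    rintro _ ⟨P, -, hP, q, hq, hqp, y, hy, u, hu, rfl⟩
    exact iterate_commutatorElement_mem_deltaStarCommutators hu
      (towerCommutators_subset_zero n q _ hy).1.2 (ih hq hy)
      (coprime_orderOf_of_mem_towerCommutators hp hq hqp.symm hP hy) le_rfl

theorem exists_mem_towerCommutators_succ_ne_one (hp : p.Prime) (hq : q.Prime) (hqp : q ≠ p)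
    (hPJ : P ≤ J) (hP : IsPGroup p P)
    (hy : y ∈ towerCommutators n q (J ⊓ Subgroup.normalizer (P : Set G))) (hu : u ∈ P)
    (huy : ⁅u, y⁆ ≠ 1) : ∃ x ∈ towerCommutators (n + 1) p J, x ≠ 1 :=
  ⟨_, ⟨P, hPJ, hP, q, hq, hqp, y, hy, u, hu, rfl⟩, fun hx =>
    huy (commutatorElement_eq_one_of_iterate_eq_one hu
      (towerCommutators_subset_zero n q _ hy).1.2
      (coprime_orderOf_of_mem_towerCommutators hp hq hqp.symm hP hy) hx)⟩

theorem towerCommutators_map_subset [Finite G] {H : Type*} [Group H] (f : G →* H)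
    (hp : p.Prime) : towerCommutators n p (J.map f) ⊆ f '' towerCommutators n p J := by
  have : Fact p.Prime := ⟨hp⟩
  induction n generalizing p J with
  | zero =>
    rintro x ⟨hxJ, hx⟩
    obtain ⟨S, hSJ, hS, hSx, -⟩ :=
      exists_isPGroup_map_inf_normalizer_eq f hx (Subgroup.zpowers_le.2 hxJ)
    obtain ⟨s, hs, rfl⟩ : x ∈ S.map f := hSx ▸ Subgroup.mem_zpowers x
    exact ⟨s, ⟨hSJ hs, hS.to_le (Subgroup.zpowers_le.2 hs)⟩, rfl⟩
  | succ n ih =>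
    rintro _ ⟨P, hPJ, hP, q, hq, hqp, y, hy, u, hu, rfl⟩
    obtain ⟨S, hSJ, hS, rfl, hSn⟩ := exists_isPGroup_map_inf_normalizer_eq f hP hPJ
    rw [← hSn] at hy
    obtain ⟨z, hz, rfl⟩ := ih hq ⟨hq⟩ hy
    obtain ⟨v, hv, rfl⟩ := hu
    refine ⟨_, ⟨S, hSJ, hS, q, hq, hqp, z, hz, v, hv, rfl⟩, ?_⟩
    exact Function.Semiconj.iterate_right (fun w => map_commutatorElement f w z) (n + 1) v

theorem eq_one_of_mem_towerCommutators_succ [Finite G] {k : ℕ}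
    (h : ∀ p q : ℕ, p.Prime → q.Prime → p ≠ q →
      ∀ a ∈ deltaStarCommutators G k, ∀ b ∈ deltaStarCommutators G k,
        IsPGroup p (Subgroup.zpowers a) → IsPGroup q (Subgroup.zpowers b) →
          orderOf (a * b) = orderOf a * orderOf b)
    (hp : p.Prime) (hx : x ∈ towerCommutators (k + 1) p J) : x = 1 := by
  have hxk : x ∈ deltaStarCommutators G k := deltaStarCommutators_antitone k.le_succ
    (towerCommutators_subset_deltaStarCommutators hp hx)
  have hxp := (towerCommutators_subset_zero _ p J hx).2
  obtain ⟨P, -, -, q, hq, hqp, y, hy, u, -, rfl⟩ := hx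
  have hyk := towerCommutators_subset_deltaStarCommutators hq hy
  have hyq := (towerCommutators_subset_zero k q _ hy).2
  have hxy := h p q hp hq hqp.symm _ hxk y hyk hxp hyq
  -- `⁅e, y⁆ * y = e * y * e⁻¹` has the same order as `y`.
  rw [Function.iterate_succ_apply', ← conj_eq_commutatorElement_mul,
    MulEquiv.orderOf_eq] at hxy
  rw [Function.iterate_succ_apply', ← orderOf_eq_one_iff]
  exact (Nat.mul_eq_right (orderOf_pos y).ne').1 hxy.symm

end TowerCommutators

section MinimalNormal

variable {G : Type*} [Group G] {V : Subgroup G}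

theorem le_centralizer_of_minimal_normal [Group.IsSolvable G]
    (hV : Minimal (fun N : Subgroup G => N.Normal ∧ N ≠ ⊥) V) :
    V ≤ Subgroup.centralizer (V : Set G) := by
  have := hV.prop.1
  rw [← Subgroup.commutator_eq_bot_iff_le_centralizer]
  by_contra hne
  have hlt : ⁅V, V⁆ < V := Group.IsSolvable.commutator_lt_of_ne_bot hV.prop.2
  exact hlt.not_ge (hV.le_of_le ⟨inferInstance, hne⟩ hlt.le)

variable [Finite G] {p : ℕ} [Fact p.Prime]

theorem exists_normal_isPGroup_of_dvd_card {N : Subgroup G} [N.Normal] [Group.IsNilpotent N]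
    (hp : p ∣ Nat.card N) : ∃ K ≤ N, K.Normal ∧ IsPGroup p K ∧ K ≠ ⊥ := by
  let S : Sylow p N := default
  have := S.characteristic_of_normal inferInstance
  refine ⟨(S : Subgroup N).map N.subtype, Subgroup.map_subtype_le _, inferInstance,
    S.isPGroup'.map _, ?_⟩
  rw [Ne, Subgroup.map_eq_bot_iff_of_injective _ N.subtype_injective]
  exact S.ne_bot_of_dvd_card hp

theorem inf_centralizer_ne_bot_of_isPGroup [V.Normal] (hp : p ∣ Nat.card V) {S : Subgroup G}
    (hS : IsPGroup p S) : V ⊓ Subgroup.centralizer (S : Set G) ≠ ⊥ := by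
  let φ : S →* MulAut V := MulAut.conjNormal.comp S.subtype
  let _ : MulAction S V := MulAction.compHom V φ
  obtain ⟨v, hv, hv1⟩ := hS.exists_fixed_point_of_prime_dvd_card_of_fixed_point V hp
    (a := 1) (fun s => map_one (φ s))
  refine fun hbot => hv1 (Subtype.ext (Subgroup.mem_bot.1 (hbot.le ⟨v.2, fun s hs => ?_⟩)).symm)
  have hsv : s * v * s⁻¹ = v := congrArg Subtype.val (hv ⟨s, hs⟩)
  exact mul_inv_eq_iff_eq_mul.1 hsv

theorem isPGroup_of_minimal_normal [Group.IsSolvable G]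
    (hV : Minimal (fun N : Subgroup G => N.Normal ∧ N ≠ ⊥) V) (hp : p ∣ Nat.card V) :
    IsPGroup p V := by
  have := hV.prop.1
  have : Group.IsNilpotent V := isNilpotent_of_commute_of_coprime_orderOf fun a b _ =>
    Subtype.ext (le_centralizer_of_minimal_normal hV b.2 a a.2)
  obtain ⟨K, hKV, hKn, hK, hK1⟩ := exists_normal_isPGroup_of_dvd_card hp
  exact hK.to_le (hV.le_of_le ⟨hKn, hK1⟩ hKV)

theorem eq_bot_of_normal_isPGroup_quotient_centralizer [V.Normal]
    (hV : Minimal (fun N : Subgroup G => N.Normal ∧ N ≠ ⊥) V) (hp : p ∣ Nat.card V)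
    {K : Subgroup (G ⧸ Subgroup.centralizer (V : Set G))} [K.Normal] (hK : IsPGroup p K) :
    K = ⊥ := by
  let f := QuotientGroup.mk' (Subgroup.centralizer (V : Set G))
  have hf : Function.Surjective f := QuotientGroup.mk'_surjective _
  have hker : f.ker = Subgroup.centralizer (V : Set G) := QuotientGroup.ker_mk' _
  obtain ⟨S, hS, hSK, -⟩ := exists_isPGroup_map_normalizer_eq_top hf hK
  have hfix : V ⊓ Subgroup.centralizer (S : Set G) ≤
      V ⊓ Subgroup.centralizer (K.comap f : Set G) := by
    refine le_inf inf_le_left ?_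
    rw [← hSK, Subgroup.comap_map_eq, hker, Subgroup.le_centralizer_iff, sup_le_iff]
    exact ⟨Subgroup.le_centralizer_iff.1 inf_le_right, Subgroup.centralizer_le inf_le_left⟩
  have hne : V ⊓ Subgroup.centralizer (K.comap f : Set G) ≠ ⊥ :=
    ne_bot_of_le_ne_bot (inf_centralizer_ne_bot_of_isPGroup hp hS) hfix
  have hVK : V ≤ Subgroup.centralizer (K.comap f : Set G) :=
    (hV.le_of_le ⟨inferInstance, hne⟩ inf_le_left).trans inf_le_right
  rw [← Subgroup.map_comap_eq_self_of_surjective hf K, Subgroup.map_eq_bot_iff]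
  exact (Subgroup.le_centralizer_iff.1 hVK).trans_eq hker.symm

end MinimalNormal

section Existence

variable {G : Type*} [Group G] [Finite G] {m n p q : ℕ}

theorem exists_lowerFittingSeries_ne_bot_not_dvd_card [Group.IsSolvable G] [Fact p.Prime]
    (hp : ∀ K : Subgroup G, K.Normal → IsPGroup p K → K = ⊥)
    (hm : lowerFittingSeries G m ≠ ⊥) :
    ∃ n ≥ m, lowerFittingSeries G n ≠ ⊥ ∧ ¬ p ∣ Nat.card (lowerFittingSeries G n) := by
  obtain ⟨n, hmn, hn, hn'⟩ := exists_lowerFittingSeries_ne_bot_succ_eq_bot hm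
  have := isNilpotent_of_coprimeCommutator_eq_bot hn'
  refine ⟨n, hmn, hn, fun hdvd => ?_⟩
  obtain ⟨K, -, hKn, hK, hK1⟩ := exists_normal_isPGroup_of_dvd_card hdvd
  exact hK1 (hp K hKn hK)

theorem card_quotient_lt {N : Subgroup G} (hN : N ≠ ⊥) : Nat.card (G ⧸ N) < Nat.card G := by
  rw [Subgroup.card_eq_card_quotient_mul_card_subgroup N]
  exact lt_mul_of_one_lt_right Nat.card_pos (N.one_lt_card_iff_ne_bot.2 hN)

theorem lowerFittingSeries_quotient_ne_bot {N : Subgroup G} [N.Normal]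
    (hN : ¬ lowerFittingSeries G n ≤ N) : lowerFittingSeries (G ⧸ N) n ≠ ⊥ := by
  rwa [← map_lowerFittingSeries (QuotientGroup.mk'_surjective N), Ne, Subgroup.map_eq_bot_iff,
    QuotientGroup.ker_mk']

theorem card_lowerFittingSeries_quotient_dvd (N : Subgroup G) [N.Normal] (n : ℕ) :
    Nat.card (lowerFittingSeries (G ⧸ N) n) ∣ Nat.card (lowerFittingSeries G n) :=
  map_lowerFittingSeries (QuotientGroup.mk'_surjective N) n ▸ Subgroup.card_map_dvd _ _

theorem lowerFittingSeries_quotient_centralizer_ne_bot (hn : lowerFittingSeries G (n + 1) ≠ ⊥) :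
    lowerFittingSeries
      (G ⧸ Subgroup.centralizer (lowerFittingSeries G (n + 1) : Set G)) n ≠ ⊥ :=
  lowerFittingSeries_quotient_ne_bot fun h =>
    hn (coprimeCommutator_eq_bot_of_le_centralizer (Subgroup.le_centralizer_iff.1 h))

theorem exists_mem_towerCommutators_map_ne_one {H : Type*} [Group H] {f : G →* H}
    (hf : Function.Surjective f) (hp : p.Prime)
    (hH : ∃ x ∈ towerCommutators n p (⊤ : Subgroup H), x ≠ 1) :
    ∃ x ∈ towerCommutators n p (⊤ : Subgroup G), f x ≠ 1 := by
  obtain ⟨x, hx, hx1⟩ := hH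
  rw [← Subgroup.map_top_of_surjective f hf] at hx
  obtain ⟨y, hy, rfl⟩ := towerCommutators_map_subset f hp hx
  exact ⟨y, hy, hx1⟩

theorem exists_mem_towerCommutators_succ_ne_one_of_quotient_centralizer {V : Subgroup G}
    [V.Normal] (hV : IsPGroup p V) (hp : p.Prime) (hq : q.Prime) (hqp : q ≠ p)
    (hx : ∃ x ∈ towerCommutators n q
      (⊤ : Subgroup (G ⧸ Subgroup.centralizer (V : Set G))), x ≠ 1) :
    ∃ x ∈ towerCommutators (n + 1) p (⊤ : Subgroup G), x ≠ 1 := by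
  obtain ⟨y, hy, hy1⟩ :=
    exists_mem_towerCommutators_map_ne_one (QuotientGroup.mk'_surjective _) hq hx
  rw [Ne, ← MonoidHom.mem_ker, QuotientGroup.ker_mk', Subgroup.mem_centralizer_iff] at hy1
  push Not at hy1
  obtain ⟨v, hv, hvy⟩ := hy1
  refine exists_mem_towerCommutators_succ_ne_one hp hq hqp le_top hV
    (by rwa [Subgroup.normalizer_eq_top, top_inf_eq]) hv ?_
  rwa [Ne, commutatorElement_eq_one_iff_mul_comm]

-- Avoiding a prescribed `r` lets the induction put a `q`-group on top of a tower found for `r = q`.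
theorem exists_mem_towerCommutators_ne_one [Group.IsSolvable G] {r : ℕ}
    (hn : lowerFittingSeries G n ≠ ⊥) (hr : ¬ r ∣ Nat.card (lowerFittingSeries G n)) :
    ∃ p, p.Prime ∧ p ≠ r ∧ ∃ x ∈ towerCommutators n p (⊤ : Subgroup G), x ≠ 1 := by
  induction hG : Nat.card G using Nat.strong_induction_on generalizing G n r with
  | _ N ih =>
  subst hG
  by_cases hmin : ∀ N : Subgroup G, N.Normal → N ≠ ⊥ → lowerFittingSeries G n ≤ N
  · have hV : Minimal (fun N : Subgroup G => N.Normal ∧ N ≠ ⊥) (lowerFittingSeries G n) :=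
      ⟨⟨inferInstance, hn⟩, fun N hN _ => hmin N hN.1 hN.2⟩
    obtain ⟨q, hq, hqV⟩ := Nat.exists_prime_and_dvd (mt Subgroup.card_eq_one.1 hn)
    have : Fact q.Prime := ⟨hq⟩
    have hVq := isPGroup_of_minimal_normal hV hqV
    refine ⟨q, hq, fun hqr => hr (hqr ▸ hqV), ?_⟩
    cases n with
    | zero =>
      obtain ⟨x, hx, hx1⟩ := (Subgroup.bot_or_exists_ne_one _).resolve_left hn
      exact ⟨x, ⟨Subgroup.mem_top x, hVq.to_le (Subgroup.zpowers_le.2 hx)⟩, hx1⟩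
    | succ m =>
      have hcent := ne_bot_of_le_ne_bot hn (le_centralizer_of_minimal_normal hV)
      obtain ⟨M, hmM, hM, hqM⟩ := exists_lowerFittingSeries_ne_bot_not_dvd_card
        (fun _ _ => eq_bot_of_normal_isPGroup_quotient_centralizer hV hqV)
        (lowerFittingSeries_quotient_centralizer_ne_bot hn)
      obtain ⟨p, hp, hpq, x, hx, hx1⟩ := ih _ (card_quotient_lt hcent) hM hqM rfl
      exact exists_mem_towerCommutators_succ_ne_one_of_quotient_centralizer hVq hq hp hpq
        ⟨x, towerCommutators_antitone p _ hmM hx, hx1⟩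
  · push Not at hmin
    obtain ⟨N, hNn, hN, hnN⟩ := hmin
    obtain ⟨p, hp, hpr, hx⟩ := ih _ (card_quotient_lt hN) (lowerFittingSeries_quotient_ne_bot hnN)
      (fun h => hr (h.trans (card_lowerFittingSeries_quotient_dvd N n))) rfl
    obtain ⟨x, hx, hx1⟩ :=
      exists_mem_towerCommutators_map_ne_one (QuotientGroup.mk'_surjective N) hp hx
    exact ⟨p, hp, hpr, x, hx, fun h => hx1 (by rw [h, map_one])⟩

end Existence

theorem mainTheorem5_general {G : Type*} [Group G] [Finite G] [Group.IsSolvable G] (k : ℕ)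
    (h : ∀ p q : ℕ, p.Prime → q.Prime → p ≠ q →
      ∀ a ∈ deltaStarCommutators G k, ∀ b ∈ deltaStarCommutators G k,
        IsPGroup p (Subgroup.zpowers a) → IsPGroup q (Subgroup.zpowers b) →
          orderOf (a * b) = orderOf a * orderOf b) :
    Group.IsNilpotent (deltaStar G k) := by
  have hbot : lowerFittingSeries G (k + 1) = ⊥ := by
    by_contra hne
    obtain ⟨p, hp, -, x, hx, hx1⟩ := exists_mem_towerCommutators_ne_one (r := 0) hne
      (by simpa only [zero_dvd_iff] using Nat.card_pos.ne')
    exact hx1 (eq_one_of_mem_towerCommutators_succ h hp hx)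
  have := isNilpotent_of_coprimeCommutator_eq_bot hbot
  exact Group.nilpotent_of_mulEquiv
    (Subgroup.subgroupOfEquivOfLe (deltaStar_le_lowerFittingSeries k))

theorem mainTheorem5 {G : Type*} [Group G] [Finite G] [Group.IsSolvable G] (k : ℕ) (hk : 1 ≤ k)
    (h : ∀ a ∈ deltaStarCommutators G k, ∀ b ∈ deltaStarCommutators G k,
      Nat.Coprime (orderOf a) (orderOf b) → orderOf (a * b) = orderOf a * orderOf b) :
    Group.IsNilpotent (deltaStar G k) :=
  mainTheorem5_general k fun _ _ hp hq hpq a ha b hb hap hbq =>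
    h a ha b hb (coprime_orderOf_of_isPGroup hap hbq ((Nat.coprime_primes hp hq).2 hpq)
      (Subgroup.mem_zpowers a) (Subgroup.mem_zpowers b))
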